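/- Let $p\in\mathbb{C}$ with $0<|p|<1$, let $\nu\in\mathbb{C}$, let $p^s=e^{s\operatorname{Log}p}$ (principal logarithm), and assume $p^{2\nu}\notin p^{\mathbb{Z}}$. Put $(a;p)_n=\prod_{k=0}^{n-1}(1-ap^k)$, $(a;p)_\infty=\prod_{k\ge 0}(1-ap^k)$, $(a,b;p)_\infty=(a;p)_\infty(b;p)_\infty$, $$\theta_p(x)=\sum_{n\in\mathbb{Z}}p^{n(n-1)/2}x^n,\qquad {}_1\varphi_1(0;b;p,x)=\sum_{n\ge 0}\frac{(-1)^np^{n(n-1)/2}}{(b;p)_n(p;p)_n}x^n,\qquad [\lambda;p]=\{\lambda p^k: k\in\mathbb{Z}\}.$$ Consider the Hahn--Exton $q$-Bessel equation, written in the variable $t=1/x$ at infinity, $$z(p^2t)-\Bigl\{(p^\nu+p^{-\nu})-\frac{p^{-2-\nu}}{t}\Bigr\}z(pt)+z(t)=0 .$$ There is exactly one sequence $(a_n)_{n\ge0}$ with $a_0=1$ such that $\sum_{n\ge0}a_nt^n$ converges on some disc $|t|<r$, $r>0$, and $$z(t)=\frac{1}{\theta_p(-p^{\nu+2}t)}\sum_{n\ge0}a_nt^n$$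 satisfies this equation for all $t$ with $0<|t|<r$ and $1/t\notin[p^{\nu+2};p]$. For this sequence the series $\sum_{n\ge0}a_nt^n$ converges for every $t\in\mathbb{C}$, and for every $x\in\mathbb{C}^*\setminus[p^{\nu+2};p]$, $$z\left(\frac1x\right)=\frac{1}{(p^{-2\nu},p;p)_\infty}\,\frac{\theta_p\left(-\frac{p^{2\nu+2}}{x}\right)}{\theta_p\left(-\frac{p^{\nu+2}}{x}\right)}\;{}_1\varphi_1\left(0;p^{1+2\nu};p,x\right)+\frac{1}{(p^{2\nu},p;p)_\infty}\,\frac{\theta_p\left(-\frac{p^{2}}{x}\right)}{\theta_p\left(-\frac{p^{\nu+2}}{x}\right)}\;{}_1\varphi_1\left(0;p^{1-2\nu};p,p^{-2\nu}x\right).$$ -/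

import Mathlib

noncomputable section

namespace HahnExton

/-- The finite `q`-shifted factorial `(a;q)_n = (1-a)(1-aq)⋯(1-aq^{n-1})`. -/
def qPoch (a q : ℂ) (n : ℕ) : ℂ := ∏ k ∈ Finset.range n, (1 - a * q ^ k)

/-- The infinite `q`-shifted factorial `(a;q)_∞`, an absolutely convergent product for `|q| < 1`. -/
def qPochInf (a q : ℂ) : ℂ := ∏' k : ℕ, (1 - a * q ^ k)

/-- The basic hypergeometric series `_rφ_s(a₁,…,a_r; b₁,…,b_s; q, x)`. -/
def basicHyp (as bs : List ℂ) (q x : ℂ) : ℂ :=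
  ∑' n : ℕ, (as.map fun a => qPoch a q n).prod /
      ((bs.map fun b => qPoch b q n).prod * qPoch q q n) *
    ((-1) ^ n * q ^ (n * (n - 1) / 2)) ^ (1 + (bs.length : ℤ) - (as.length : ℤ)) * x ^ n

/-- The theta function of Jacobi, `θ_q(x) = ∑_{n ∈ ℤ} q^{n(n-1)/2} x^n`
(the division in the exponent is exact). -/
def theta (q x : ℂ) : ℂ := ∑' n : ℤ, q ^ (n * (n - 1) / 2) * x ^ n

/-- The `q`-spiral `[c;q] = c q^ℤ`. -/
def qSpiral (c q : ℂ) : Set ℂ := {x | ∃ k : ℤ, x = c * q ^ k}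

/-- The function `z(t) = θ_p(-p^{ν+2} t)⁻¹ ∑_{n ≥ 0} a_n t^n`. -/
def zFun (p ν : ℂ) (a : ℕ → ℂ) (t : ℂ) : ℂ :=
  (theta p (-(p ^ (ν + 2) * t)))⁻¹ * ∑' n : ℕ, a n * t ^ n

/-- The Hahn–Exton equation in the variable `t = 1/x` at infinity, at the point `t`:
`z(p²t) - {(p^ν + p^{-ν}) - p^{-2-ν}/t} z(pt) + z(t) = 0`. -/
def HahnExtonEqAt (p ν : ℂ) (z : ℂ → ℂ) (t : ℂ) : Prop :=
  z (p ^ 2 * t) - ((p ^ ν + p ^ (-ν)) - p ^ (-2 - ν) / t) * z (p * t) + z t = 0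

/-- `a` is the coefficient sequence of a solution at infinity: `a_0 = 1`, and on some disc
`|t| < r` the series `∑ a_n t^n` converges and `z(t) = θ_p(-p^{ν+2} t)⁻¹ ∑ a_n t^n` satisfies the
Hahn–Exton equation at every `t ≠ 0` that is not a pole of the prefactor. -/
def IsSolutionAtInfinity (p ν : ℂ) (a : ℕ → ℂ) : Prop :=
  a 0 = 1 ∧ ∃ r : ℝ, 0 < r ∧
    (∀ t : ℂ, ‖t‖ < r → Summable fun n : ℕ => a n * t ^ n) ∧
    ∀ t : ℂ, t ≠ 0 → ‖t‖ < r → 1 / t ∉ qSpiral (p ^ (ν + 2)) p →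
      HahnExtonEqAt p ν (zFun p ν a) t

end HahnExton

end

noncomputable section

namespace HahnExton

open Filter Topology Finset

/-! Put `z = p ^ (2 * ν)`. Since `θ(px) = θ(x)/x`, the equation for `z(t) = f(t)/θ` becomes a
theta-free functional equation for `f = ∑ a_n t^n`, that is, a three-term recurrence for the `a_n`.
Its leading coefficient `1 - p^n` is nonzero for `n ≥ 1`, so `a_0 = 1` fixes the sequence.

The connection formula is read backwards. The numerator `connRHS` of its right-hand side has an
explicit Laurent series in `t` (`hasSum_theta_mul_basicHyp`), whose coefficients obey the same
recurrence for all `n ∈ ℤ` (`solCoeff_recurrence`). Cauchy's identity (`tauSeries_inv`) makes the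
coefficient at `-1` vanish, the Casoratian (`casoratian`) makes the one at `0` equal to `1`, and the
recurrence then kills every negative index. Hence the numerator is an entire power series, and
uniqueness identifies it with `f`. -/

lemma qPoch_zero (a q : ℂ) : qPoch a q 0 = 1 := by simp [qPoch]

lemma qPoch_succ (a q : ℂ) (n : ℕ) : qPoch a q (n + 1) = qPoch a q n * (1 - a * q ^ n) := by
  simp [qPoch, prod_range_succ]

lemma qPoch_succ' (a q : ℂ) (n : ℕ) :
    qPoch a q (n + 1) = (1 - a) * qPoch (a * q) q n := by
  simp only [qPoch, prod_range_succ', pow_zero, mul_one]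
  rw [mul_comm]
  congr 1
  exact prod_congr rfl fun k _ => by ring

lemma qPoch_ne_zero {a q : ℂ} (h : ∀ k : ℕ, a * q ^ k ≠ 1) (n : ℕ) : qPoch a q n ≠ 0 :=
  prod_ne_zero_iff.2 fun k _ => sub_ne_zero.2 (h k).symm

lemma summable_const_mul_pow (a : ℂ) {q : ℂ} (hq : ‖q‖ < 1) :
    Summable fun k : ℕ => ‖-(a * q ^ k)‖ := by
  simp only [norm_neg, norm_mul, norm_pow]
  exact (summable_geometric_of_lt_one (norm_nonneg _) hq).mul_left _

lemma multipliable_one_sub (a : ℂ) {q : ℂ} (hq : ‖q‖ < 1) :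
    Multipliable fun k : ℕ => (1 - a * q ^ k) := by
  simpa [sub_eq_add_neg] using multipliable_one_add_of_summable (summable_const_mul_pow a hq)

lemma tendsto_qPoch (a : ℂ) {q : ℂ} (hq : ‖q‖ < 1) :
    Tendsto (qPoch a q) atTop (𝓝 (qPochInf a q)) :=
  (multipliable_one_sub a hq).hasProd.tendsto_prod_nat

lemma qPochInf_ne_zero {a q : ℂ} (hq : ‖q‖ < 1) (h : ∀ k : ℕ, a * q ^ k ≠ 1) :
    qPochInf a q ≠ 0 := by
  have := tprod_one_add_ne_zero_of_summable (f := fun k : ℕ => -(a * q ^ k))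
    (fun k => by rw [← sub_eq_add_neg]; exact sub_ne_zero.2 (h k).symm)
    (summable_const_mul_pow a hq)
  simpa [qPochInf, sub_eq_add_neg] using this

lemma qPochInf_eq (a : ℂ) {q : ℂ} (hq : ‖q‖ < 1) :
    qPochInf a q = (1 - a) * qPochInf (a * q) q := by
  refine tendsto_nhds_unique ((tendsto_add_atTop_iff_nat 1).2 (tendsto_qPoch a hq)) ?_
  simp only [qPoch_succ']
  exact (tendsto_qPoch (a * q) hq).const_mul _

lemma self_mul_pow_ne_one {q : ℂ} (hq : ‖q‖ < 1) (k : ℕ) : q * q ^ k ≠ 1 := by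
  intro h
  have := congrArg norm h
  rw [← pow_succ', norm_pow, norm_one] at this
  exact (pow_lt_one₀ (norm_nonneg q) hq (Nat.succ_ne_zero k)).ne this

lemma qPoch_self_ne_zero {q : ℂ} (hq : ‖q‖ < 1) (n : ℕ) : qPoch q q n ≠ 0 :=
  qPoch_ne_zero (self_mul_pow_ne_one hq) n

lemma tendsto_pow_nhds_zero {q : ℂ} (hq : ‖q‖ < 1) : Tendsto (fun n : ℕ => q ^ n) atTop (𝓝 0) :=
  tendsto_pow_atTop_nhds_zero_of_norm_lt_one hq

/-! ### The entire series governing the Laurent coefficients -/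

/-- The coefficients `p^{j²+j} w^j / ((pw;p)_j (p;p)_j)`. -/
def tau (p w : ℂ) (j : ℕ) : ℂ := p ^ (j ^ 2 + j) * w ^ j / (qPoch (p * w) p j * qPoch p p j)

/-- The entire function `∑_j p^{j²+j} w^j y^j / ((pw;p)_j (p;p)_j)`. -/
def tauSeries (p w y : ℂ) : ℂ := ∑' j : ℕ, tau p w j * y ^ j

lemma tau_zero (p w : ℂ) : tau p w 0 = 1 := by simp [tau, qPoch_zero]

lemma tau_succ (p w : ℂ) (j : ℕ) : tau p w (j + 1) =
    tau p w j * (p ^ (2 * j + 2) * w / ((1 - p * w * p ^ j) * (1 - p * p ^ j))) := by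
  simp only [tau, qPoch_succ]
  rw [div_mul_div_comm]
  congr 1 <;> ring

/-- A ratio test for power series whose coefficient ratios tend to zero. -/
lemma summable_norm_of_ratio {f : ℕ → ℂ} {g : ℕ → ℂ} (h : ∀ n, f (n + 1) = f n * g n)
    (hg : Tendsto g atTop (𝓝 0)) : Summable fun n => ‖f n‖ := by
  refine summable_of_ratio_norm_eventually_le (r := 1 / 2) (by norm_num) ?_
  have := hg.norm.eventually_le_const (u := 1 / 2) (by simp)
  filter_upwards [this] with n hn
  rw [norm_norm, norm_norm, h, norm_mul, mul_comm]
  gcongr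

lemma summable_norm_tau (p w y : ℂ) (hp1 : ‖p‖ < 1) :
    Summable fun j : ℕ => ‖tau p w j * y ^ j‖ := by
  refine summable_norm_of_ratio (g := fun j => p ^ (2 * j + 2) * w /
    ((1 - p * w * p ^ j) * (1 - p * p ^ j)) * y) (fun j => by rw [tau_succ]; ring) ?_
  have h := tendsto_pow_nhds_zero hp1
  have h1 : Tendsto (fun j : ℕ => p ^ (2 * j + 2) * w /
      ((1 - p * w * p ^ j) * (1 - p * p ^ j)) * y) atTop
      (𝓝 (0 * 0 * p ^ 2 * w / ((1 - p * w * 0) * (1 - p * 0)) * y)) := by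
    refine Tendsto.mul_const _ (Tendsto.div ?_ ?_ (by simp))
    · refine Tendsto.mul_const _ ?_
      refine (((h.mul h)).mul_const (p ^ 2)).congr fun j => by ring
    · exact (tendsto_const_nhds.sub (h.const_mul _)).mul (tendsto_const_nhds.sub (h.const_mul _))
  simpa using h1

lemma hasSum_tauSeries (p w y : ℂ) (hp1 : ‖p‖ < 1) :
    HasSum (fun j : ℕ => tau p w j * y ^ j) (tauSeries p w y) :=
  (summable_norm_tau p w y hp1).of_norm.hasSum

lemma tauSeries_zero (p w : ℂ) : tauSeries p w 0 = 1 := by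
  rw [tauSeries, tsum_eq_single 0]
  · simp [tau_zero]
  · intro j hj; simp [hj]

/-- Compare coefficients of `y^(j+1)`: with `q = p^(j+1)`, the factorization `w q² - (1+w) q + 1 =
(1-q)(1-wq)` is exactly the denominator in `tau_succ`. -/
lemma tauSeries_recurrence {p w : ℂ} (hp1 : ‖p‖ < 1) (hw : ∀ k : ℕ, p * w * p ^ k ≠ 1) (y : ℂ) :
    w * (1 - p ^ 2 * y) * tauSeries p w (p ^ 2 * y) =
      (1 + w) * tauSeries p w (p * y) - tauSeries p w y := by
  have h2 := hasSum_tauSeries p w (p ^ 2 * y) hp1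
  have h := ((h2.mul_left w).sub ((hasSum_tauSeries p w (p * y) hp1).mul_left (1 + w))).add
    (hasSum_tauSeries p w y hp1)
  rw [← hasSum_nat_add_iff' 1] at h
  have h3 := h.unique ((h2.mul_left (w * p ^ 2 * y)).congr_fun ?_)
  · simp only [range_one, sum_singleton, pow_zero, tau_zero] at h3
    linear_combination h3
  · intro j
    have e1 : (1 - p * w * p ^ j) ≠ 0 := sub_ne_zero.2 (hw j).symm
    have e2 : (1 - p * p ^ j) ≠ 0 := sub_ne_zero.2 (self_mul_pow_ne_one hp1 j).symm
    rw [tau_succ, show p ^ (2 * j + 2) = (p ^ j) ^ 2 * p ^ 2 by ring]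
    simp only [mul_pow, pow_succ _ j, ← pow_mul, mul_comm 2 j]
    simp only [pow_mul]
    generalize p ^ j = P at *
    have hq := div_mul_cancel₀ (P ^ 2 * p ^ 2 * w) (mul_ne_zero e1 e2)
    linear_combination (tau p w j * y ^ j * y) * hq

lemma continuous_tauSeries (p w : ℂ) (hp1 : ‖p‖ < 1) : Continuous (tauSeries p w) := by
  rw [continuous_iff_continuousAt]
  intro y
  have hc : ContinuousOn (tauSeries p w) (Metric.ball 0 (‖y‖ + 1)) := by
    refine continuousOn_tsum (u := fun j => ‖tau p w j * ((‖y‖ + 1 : ℝ) : ℂ) ^ j‖)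
      (fun j => by fun_prop) (summable_norm_tau p w _ hp1) ?_
    intro j x hx
    have : ‖x‖ ≤ ‖y‖ + 1 := by simpa using (Metric.mem_ball.1 hx).le
    have h0 : |‖y‖ + 1| = ‖y‖ + 1 := abs_of_nonneg (by positivity)
    simp only [norm_mul, norm_pow, Complex.norm_real, Real.norm_eq_abs, h0]
    gcongr
  exact hc.continuousAt (Metric.isOpen_ball.mem_nhds (by simp))

/-! ### Gaussian binomials and Cauchy's identity -/

/-- The Gaussian binomial coefficient. -/
def qBinom (p : ℂ) : ℕ → ℕ → ℂ
  | _, 0 => 1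
  | 0, _ + 1 => 0
  | n + 1, k + 1 => qBinom p n (k + 1) + p ^ (n - k) * qBinom p n k

lemma qBinom_eq_zero (p : ℂ) {n k : ℕ} (h : n < k) : qBinom p n k = 0 := by
  induction n generalizing k with
  | zero =>
    obtain ⟨k, rfl⟩ := Nat.exists_eq_succ_of_ne_zero h.ne'
    rfl
  | succ n ih =>
    obtain ⟨k, rfl⟩ := Nat.exists_eq_succ_of_ne_zero (by omega : k ≠ 0)
    simp only [qBinom]
    rw [ih (by omega), ih (by omega)]
    simp

lemma qBinom_zero_right (p : ℂ) (n : ℕ) : qBinom p n 0 = 1 := by cases n <;> rfl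

lemma qBinom_add_mul (p : ℂ) (m k : ℕ) :
    qBinom p (m + k) k * (qPoch p p k * qPoch p p m) = qPoch p p (m + k) := by
  induction hn : m + k generalizing m k with
  | zero =>
    obtain ⟨rfl, rfl⟩ : m = 0 ∧ k = 0 := by omega
    simp [qBinom, qPoch_zero]
  | succ n ih =>
    rcases k with _ | k
    · obtain rfl : m = n + 1 := by omega
      simp [qBinom_zero_right, qPoch_zero]
    · obtain rfl : n = m + k := by omega
      simp only [qBinom, Nat.add_sub_cancel]
      have h2 := ih m k rfl
      rcases m with _ | m
      · rw [qBinom_eq_zero p (by omega), qPoch_succ p p k, qPoch_succ p p (0 + k)]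
        simp only [zero_add] at h2 ⊢
        linear_combination (1 - p * p ^ k) * h2
      · have h1 := ih m (k + 1) (by omega)
        rw [show m + 1 + k = m + (k + 1) by ring] at h1 h2 ⊢
        rw [qPoch_succ p p m] at h2 ⊢
        rw [qPoch_succ p p k] at h1 ⊢
        rw [show m + (k + 1) + 1 = (m + (k + 1)) + 1 from rfl, qPoch_succ p p (m + (k + 1))]
        linear_combination (1 - p * p ^ m) * h1 + p ^ (m + 1) * (1 - p * p ^ k) * h2

/-- A finite form of Cauchy's identity. -/
lemma sum_qBinom {p w : ℂ} (hw : ∀ k : ℕ, p * w * p ^ k ≠ 1) (n : ℕ) :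
    ∑ j ∈ range (n + 1), qBinom p n j * (p ^ (j ^ 2) * w ^ j / qPoch (p * w) p j) =
      1 / qPoch (p * w) p n := by
  induction n generalizing w with
  | zero => simp [qBinom, qPoch_zero]
  | succ n ih =>
    have hw' : ∀ k : ℕ, p * (p * w) * p ^ k ≠ 1 := fun k => by
      have := hw (k + 1); rwa [show p * (p * w) * p ^ k = p * w * p ^ (k + 1) by ring]
    have h1 := ih hw
    have h2 := ih hw'
    have e0 : 1 - p * w ≠ 0 := sub_ne_zero.2 (by simpa using (hw 0).symm)
    have e1 := qPoch_ne_zero hw n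
    have e2 := qPoch_ne_zero hw' n
    have e3 : 1 - p * w * p ^ n ≠ 0 := sub_ne_zero.2 (hw n).symm
    have e4 := qPoch_succ (p * w) p n
    have e5 := qPoch_succ' (p * w) p n
    rw [show p * w * p = p * (p * w) by ring] at e5
    rw [sum_range_succ']
    -- Pascal's rule, with `(pw;p)_{k+1} = (1-pw)(p²w;p)_k`: the second piece is the level-`n`
    -- summand for `pw`, which is why the induction runs over all `w`.
    have key : ∀ k ∈ range (n + 1), qBinom p (n + 1) (k + 1) *
        (p ^ ((k + 1) ^ 2) * w ^ (k + 1) / qPoch (p * w) p (k + 1)) =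
        qBinom p n (k + 1) * (p ^ ((k + 1) ^ 2) * w ^ (k + 1) / qPoch (p * w) p (k + 1)) +
        p ^ (n + 1) * w / (1 - p * w) *
          (qBinom p n k * (p ^ (k ^ 2) * (p * w) ^ k / qPoch (p * (p * w)) p k)) := by
      intro k hk
      have hk : k ≤ n := by simpa [Nat.lt_succ_iff] using hk
      obtain ⟨m, rfl⟩ := Nat.exists_eq_add_of_le hk
      have e6 := qPoch_succ' (p * w) p k
      rw [show p * w * p = p * (p * w) by ring] at e6
      have e7 := qPoch_ne_zero hw' k
      rw [e6]
      simp only [qBinom, Nat.add_sub_cancel_left]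
      field_simp
      ring
    rw [sum_congr rfl key, sum_add_distrib, ← mul_sum, h2, add_right_comm,
      sum_range_succ, qBinom_eq_zero p (Nat.lt_succ_self n)]
    rw [sum_range_succ'] at h1
    simp only [qBinom_zero_right] at h1 ⊢
    rw [zero_mul, add_zero, h1, e5]
    have e8 : qPoch (p * w) p n * (1 - p * w * p ^ n) = (1 - p * w) * qPoch (p * (p * w)) p n :=
      e4.symm.trans e5
    have e9 : qPoch (p * w) p n = (1 - p * w) * qPoch (p * (p * w)) p n / (1 - p * w * p ^ n) := by
      rw [← e8]; field_simp
    rw [e9]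
    field_simp
    ring

/-- Cauchy's identity `∑_j p^{j²} w^j / ((pw;p)_j (p;p)_j) = 1 / (pw;p)_∞`. -/
lemma tauSeries_inv {p w : ℂ} (hp0 : p ≠ 0) (hp1 : ‖p‖ < 1) (hw : ∀ k : ℕ, p * w * p ^ k ≠ 1) :
    tauSeries p w p⁻¹ = 1 / qPochInf (p * w) p := by
  have hinf : qPochInf p p ≠ 0 := qPochInf_ne_zero hp1 (self_mul_pow_ne_one hp1)
  have hlim := tendsto_qPoch p hp1
  obtain ⟨C, hC⟩ := (Metric.isBounded_range_of_tendsto _ hlim).exists_norm_le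
  obtain ⟨C', hC'⟩ := (Metric.isBounded_range_of_tendsto _ (hlim.inv₀ hinf)).exists_norm_le
  have hterm : ∀ j : ℕ, p ^ (j ^ 2) * w ^ j / qPoch (p * w) p j =
      qPoch p p j * (tau p w j * p⁻¹ ^ j) := fun j => by
    have := qPoch_self_ne_zero hp1 j
    have := qPoch_ne_zero hw j
    simp only [tau, pow_add, inv_pow]
    field_simp
  have hformula : ∀ j n : ℕ, j ≤ n → qBinom p n j * qPoch p p j =
      qPoch p p n * (qPoch p p (n - j))⁻¹ := fun j n h => by
    obtain ⟨m, rfl⟩ := Nat.exists_eq_add_of_le' h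
    have := qPoch_self_ne_zero hp1 m
    rw [Nat.add_sub_cancel, ← qBinom_add_mul]
    field_simp
  -- Tannery's argument on the finite identity: `qBinom p n j * qPoch p p j` tends to `1` as `n → ∞`
  -- and is bounded by `C * C'` uniformly in `n` and `j`.
  refine tendsto_nhds_unique (f := fun n : ℕ => ∑' j : ℕ,
    qBinom p n j * qPoch p p j * (tau p w j * p⁻¹ ^ j)) (l := atTop) ?_ ?_
  · refine tendsto_tsum_of_dominated_convergence
      (bound := fun j => C * C' * ‖tau p w j * p⁻¹ ^ j‖)
      ((summable_norm_tau p w _ hp1).mul_left _) ?_ ?_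
    · intro j
      have : Tendsto (fun n => qPoch p p n * (qPoch p p (n - j))⁻¹) atTop (𝓝 1) := by
        have := hlim.mul ((hlim.comp (tendsto_sub_atTop_nat j)).inv₀ hinf)
        rwa [mul_inv_cancel₀ hinf] at this
      have h' : Tendsto (fun n => qBinom p n j * qPoch p p j) atTop (𝓝 1) := by
        refine this.congr' ?_
        filter_upwards [eventually_ge_atTop j] with n hn using (hformula j n hn).symm
      simpa using h'.mul_const (tau p w j * p⁻¹ ^ j)
    · refine Eventually.of_forall fun n j => ?_
      rw [norm_mul]
      gcongr
      rcases le_or_gt j n with h | h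
      · rw [hformula j n h, norm_mul]
        have a1 := hC _ ⟨n, rfl⟩
        have a2 := hC' _ ⟨n - j, rfl⟩
        exact mul_le_mul a1 a2 (norm_nonneg _) ((norm_nonneg _).trans a1)
      · rw [qBinom_eq_zero p h]
        have a1 := hC _ ⟨n, rfl⟩
        have a2 := hC' _ ⟨n, rfl⟩
        simpa using mul_nonneg ((norm_nonneg _).trans a1) ((norm_nonneg _).trans a2)
  · have hinf' := qPochInf_ne_zero hp1 hw
    refine (((tendsto_qPoch (p * w) hp1).inv₀ hinf').congr fun n => ?_).trans (by simp)
    rw [tsum_eq_sum (s := range (n + 1))]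
    · rw [← one_div, ← sum_qBinom hw n]
      exact sum_congr rfl fun j _ => by rw [hterm]; ring
    · intro j hj
      rw [qBinom_eq_zero p (by simpa using hj)]
      simp

/-! ### The Casoratian of two solutions -/

/-- The Casoratian identity at `y = 1`. -/
lemma casoratian {p z : ℂ} (hp0 : p ≠ 0) (hp1 : ‖p‖ < 1) (hz0 : z ≠ 0)
    (hz : ∀ k : ℕ, p * z * p ^ k ≠ 1) (hz' : ∀ k : ℕ, p * z⁻¹ * p ^ k ≠ 1) :
    tauSeries p z⁻¹ 1 * tauSeries p z p⁻¹ * z⁻¹ - tauSeries p z⁻¹ p⁻¹ * tauSeries p z 1 =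
      qPochInf p p * (z⁻¹ - 1) := by
  set W : ℂ → ℂ := fun y =>
    tauSeries p z⁻¹ (p * y) * tauSeries p z y * z⁻¹ - tauSeries p z⁻¹ y * tauSeries p z (p * y)
    with hW
  have step : ∀ y, (1 - p ^ 2 * y) * W (p * y) = W y := fun y => by
    have h1 := tauSeries_recurrence hp1 hz y
    have h2 := tauSeries_recurrence hp1 hz' y
    simp only [hW]
    rw [show p * (p * y) = p ^ 2 * y by ring]
    have h1' : (1 - p ^ 2 * y) * tauSeries p z (p ^ 2 * y) =
        z⁻¹ * ((1 + z) * tauSeries p z (p * y) - tauSeries p z y) := by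
      rw [← h1]; field_simp
    have h2' : (1 - p ^ 2 * y) * tauSeries p z⁻¹ (p ^ 2 * y) =
        z * ((1 + z⁻¹) * tauSeries p z⁻¹ (p * y) - tauSeries p z⁻¹ y) := by
      rw [← h2]; field_simp
    calc _ = ((1 - p ^ 2 * y) * tauSeries p z⁻¹ (p ^ 2 * y)) * tauSeries p z (p * y) * z⁻¹
          - tauSeries p z⁻¹ (p * y) * ((1 - p ^ 2 * y) * tauSeries p z (p ^ 2 * y)) := by ring
      _ = _ := by
        rw [h1', h2']
        field_simp
        ring
  -- Starting at `y = p⁻¹`, the factors `1 - p² y` become `1 - p^(n+1)` and build `(p;p)_n`. As the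
  -- argument tends to `0`, continuity leaves `(p;p)_∞ W(0)`.
  have iter : ∀ n : ℕ, qPoch p p n * W (p ^ n * p⁻¹) = W p⁻¹ := fun n => by
    induction n with
    | zero => simp [qPoch_zero]
    | succ n ih =>
      rw [← ih, qPoch_succ, ← step (p ^ n * p⁻¹)]
      rw [show p ^ 2 * (p ^ n * p⁻¹) = p * p ^ n by field_simp,
        show p * (p ^ n * p⁻¹) = p ^ (n + 1) * p⁻¹ by ring]
      ring
  have hcont : Continuous W := by
    have := continuous_tauSeries p z hp1
    have := continuous_tauSeries p z⁻¹ hp1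
    fun_prop
  have hl : Tendsto (fun n : ℕ => p ^ n * p⁻¹) atTop (𝓝 0) := by
    simpa using (tendsto_pow_nhds_zero hp1).mul_const p⁻¹
  have hlim := (tendsto_qPoch p hp1).mul ((hcont.tendsto 0).comp hl)
  have := tendsto_nhds_unique (hlim.congr fun n => iter n) tendsto_const_nhds
  have h0 : W 0 = z⁻¹ - 1 := by simp [hW, tauSeries_zero]
  rw [h0] at this
  rw [this]
  simp [hW, hp0]

/-! ### The connection sequence: recurrence and initial values -/

section avoid

variable {p z : ℂ}

lemma mul_pow_ne_one_of_ne_zpow (hz : ∀ k : ℤ, z ≠ p ^ k) (k : ℕ) :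
    z * p ^ k ≠ 1 := by
  intro h
  refine hz (-k) ?_
  rw [zpow_neg, zpow_natCast]
  exact eq_inv_of_mul_eq_one_left h

lemma self_mul_mul_pow_ne_one (hz : ∀ k : ℤ, z ≠ p ^ k) (k : ℕ) :
    p * z * p ^ k ≠ 1 := by
  rw [show p * z * p ^ k = z * p ^ (k + 1) by ring]
  exact mul_pow_ne_one_of_ne_zpow hz (k + 1)

lemma inv_ne_zpow (hz : ∀ k : ℤ, z ≠ p ^ k) (k : ℤ) : z⁻¹ ≠ p ^ k := by
  intro h
  refine hz (-k) ?_
  rw [zpow_neg, ← h, inv_inv]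

end avoid

/-- The connection sequence
`z^n U(z, p^n) / (z⁻¹, p; p)_∞ + U(z⁻¹, p^n) / (z, p; p)_∞`, where `U = tauSeries p`. -/
def connSeq (p z : ℂ) (n : ℤ) : ℂ :=
  1 / (qPochInf z⁻¹ p * qPochInf p p) * (z ^ n * tauSeries p z (p ^ n)) +
    1 / (qPochInf z p * qPochInf p p) * tauSeries p z⁻¹ (p ^ n)

section connSeq

variable {p z : ℂ}

/-- Taking `y = p^n` in `tauSeries_recurrence`, both `z^n U(z, p^n)` and `U(z⁻¹, p^n)` solve this
recurrence, hence so does any combination of them. -/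
lemma connSeq_recurrence (hp0 : p ≠ 0) (hp1 : ‖p‖ < 1) (hz0 : z ≠ 0) (hz : ∀ k : ℤ, z ≠ p ^ k)
    (n : ℤ) : (1 - p ^ (n + 2)) * connSeq p z (n + 2) =
      (1 + z) * connSeq p z (n + 1) - z * connSeq p z n := by
  have h1 := tauSeries_recurrence hp1 (self_mul_mul_pow_ne_one hz) (p ^ n)
  have h2 := tauSeries_recurrence hp1 (self_mul_mul_pow_ne_one (inv_ne_zpow hz)) (p ^ n)
  have e1 : p ^ (n + 1) = p * p ^ n := by rw [zpow_add₀ hp0]; simp [mul_comm]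
  have e2 : p ^ (n + 2) = p ^ 2 * p ^ n := by rw [zpow_add₀ hp0, mul_comm]; norm_cast
  have e3 : z ^ (n + 1) = z * z ^ n := by rw [zpow_add₀ hz0]; simp [mul_comm]
  have e4 : z ^ (n + 2) = z ^ 2 * z ^ n := by rw [zpow_add₀ hz0, mul_comm]; norm_cast
  have h2' : (1 - p ^ 2 * p ^ n) * tauSeries p z⁻¹ (p ^ 2 * p ^ n) =
      z * ((1 + z⁻¹) * tauSeries p z⁻¹ (p * p ^ n) - tauSeries p z⁻¹ (p ^ n)) := by
    rw [← h2]; field_simp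
  have h2'' : (1 - p ^ 2 * p ^ n) * tauSeries p z⁻¹ (p ^ 2 * p ^ n) =
      (1 + z) * tauSeries p z⁻¹ (p * p ^ n) - z * tauSeries p z⁻¹ (p ^ n) := by
    rw [h2']; field_simp; ring
  simp only [connSeq, e1, e2, e3, e4]
  linear_combination 1 / (qPochInf z⁻¹ p * qPochInf p p) * z ^ n * z * h1 +
    1 / (qPochInf z p * qPochInf p p) * h2''

/-- Cauchy's identity evaluates both series at `p⁻¹`. After splitting off the first factors of
`(z;p)_∞` and `(z⁻¹;p)_∞`, what remains is `1/(z-1) + 1/(1-z) = 0`. -/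
lemma connSeq_neg_one (hp0 : p ≠ 0) (hp1 : ‖p‖ < 1) (hz0 : z ≠ 0) (hz : ∀ k : ℤ, z ≠ p ^ k) :
    connSeq p z (-1) = 0 := by
  have hz' := inv_ne_zpow hz
  have e1 := tauSeries_inv hp0 hp1 (self_mul_mul_pow_ne_one hz)
  have e2 := tauSeries_inv hp0 hp1 (self_mul_mul_pow_ne_one hz')
  have n1 := qPochInf_ne_zero hp1 (self_mul_mul_pow_ne_one hz)
  have n2 := qPochInf_ne_zero hp1 (self_mul_mul_pow_ne_one hz')
  have n3 := qPochInf_ne_zero hp1 (self_mul_pow_ne_one hp1)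
  have n4 : 1 - z ≠ 0 := sub_ne_zero.2 (by simpa using (hz 0).symm)
  have n5 : z - 1 ≠ 0 := sub_ne_zero.2 (by simpa using hz 0)
  simp only [connSeq, zpow_neg_one]
  rw [e1, e2, qPochInf_eq z hp1, qPochInf_eq z⁻¹ hp1, mul_comm z p, mul_comm z⁻¹ p,
    show 1 - z⁻¹ = (z - 1) / z by field_simp]
  field_simp
  ring

/-- With Cauchy's values at `p⁻¹` inserted, the Casoratian is a linear relation between `U(z, 1)`
and `U(z⁻¹, 1)`: precisely this normalization. -/
lemma connSeq_zero (hp0 : p ≠ 0) (hp1 : ‖p‖ < 1) (hz0 : z ≠ 0) (hz : ∀ k : ℤ, z ≠ p ^ k) :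
    connSeq p z 0 = 1 := by
  have hz' := inv_ne_zpow hz
  have e1 := tauSeries_inv hp0 hp1 (self_mul_mul_pow_ne_one hz)
  have e2 := tauSeries_inv hp0 hp1 (self_mul_mul_pow_ne_one hz')
  have n1 := qPochInf_ne_zero hp1 (self_mul_mul_pow_ne_one hz)
  have n2 := qPochInf_ne_zero hp1 (self_mul_mul_pow_ne_one hz')
  have n3 := qPochInf_ne_zero hp1 (self_mul_pow_ne_one hp1)
  have n4 : 1 - z ≠ 0 := sub_ne_zero.2 (by simpa using (hz 0).symm)
  have n5 : z - 1 ≠ 0 := sub_ne_zero.2 (by simpa using hz 0)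
  have h := casoratian hp0 hp1 hz0 (self_mul_mul_pow_ne_one hz)
    (self_mul_mul_pow_ne_one hz')
  rw [e1, e2, show z⁻¹ - 1 = (1 - z) / z by field_simp] at h
  simp only [connSeq, zpow_zero]
  rw [qPochInf_eq z hp1, qPochInf_eq z⁻¹ hp1, mul_comm z p, mul_comm z⁻¹ p,
    show 1 - z⁻¹ = -(1 - z) / z by field_simp; ring]
  field_simp at h ⊢
  linear_combination h

lemma connSeq_of_neg (hp0 : p ≠ 0) (hp1 : ‖p‖ < 1) (hz0 : z ≠ 0) (hz : ∀ k : ℤ, z ≠ p ^ k)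
    {n : ℤ} (hn : n < 0) : connSeq p z n = 0 := by
  have key : ∀ m : ℕ, connSeq p z (-m - 1) = 0 ∧ connSeq p z (-m - 2) = 0 := by
    intro m
    induction m with
    | zero =>
      have h1 := connSeq_neg_one hp0 hp1 hz0 hz
      -- At `n = -2` the factor `1 - p^(n+2)` is zero, so the value `1` at index `0` does not
      -- propagate downwards.
      have h2 := connSeq_recurrence hp0 hp1 hz0 hz (-2)
      norm_num [h1] at h2 ⊢
      exact h2.resolve_left hz0
    | succ m ih =>
      have h2 := connSeq_recurrence hp0 hp1 hz0 hz (-m - 3)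
      rw [show (-m - 3 + 2 : ℤ) = -m - 1 by ring, show (-m - 3 + 1 : ℤ) = -m - 2 by ring,
        ih.1, ih.2] at h2
      push_cast
      rw [show (-(m + 1) - 1 : ℤ) = -m - 2 by ring, show (-(m + 1) - 2 : ℤ) = -m - 3 by ring]
      refine ⟨ih.2, ?_⟩
      simpa [hz0] using h2
  have := (key (-n - 1).toNat).1
  rwa [Int.toNat_of_nonneg (by omega), show (-(-n - 1) - 1 : ℤ) = n by ring] at this

end connSeq

/-! ### Coefficients of the solution at infinity -/

/-- The coefficients of the solution at infinity, indexed by `ℤ`. -/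
def solCoeff (p z : ℂ) (n : ℤ) : ℂ := (-1) ^ n * p ^ (n * (n + 3) / 2) * connSeq p z n

lemma two_mul_triangle (n : ℤ) : 2 * (n * (n - 1) / 2) = n * (n - 1) :=
  Int.mul_ediv_cancel' (Int.even_mul_pred_self n).two_dvd

lemma two_mul_shifted_triangle (n : ℤ) : 2 * (n * (n + 3) / 2) = n * (n + 3) := by
  refine Int.mul_ediv_cancel' ?_
  have := (Int.even_mul_succ_self n).two_dvd
  rw [show n * (n + 3) = n * (n + 1) + 2 * n by ring]
  exact this.add (Dvd.intro _ rfl)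

lemma triangle_add_one (n : ℤ) : (n + 1) * (n + 1 - 1) / 2 = n * (n - 1) / 2 + n := by
  have h1 := two_mul_triangle n
  have h2 := two_mul_triangle (n + 1)
  linarith

lemma solCoeff_zero {p z : ℂ} (hp0 : p ≠ 0) (hp1 : ‖p‖ < 1) (hz0 : z ≠ 0)
    (hz : ∀ k : ℤ, z ≠ p ^ k) : solCoeff p z 0 = 1 := by
  simp [solCoeff, connSeq_zero hp0 hp1 hz0 hz]

lemma solCoeff_of_neg {p z : ℂ} (hp0 : p ≠ 0) (hp1 : ‖p‖ < 1) (hz0 : z ≠ 0)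
    (hz : ∀ k : ℤ, z ≠ p ^ k) {n : ℤ} (hn : n < 0) : solCoeff p z n = 0 := by
  simp [solCoeff, connSeq_of_neg hp0 hp1 hz0 hz hn]

lemma solCoeff_recurrence {p z : ℂ} (hp0 : p ≠ 0) (hp1 : ‖p‖ < 1) (hz0 : z ≠ 0)
    (hz : ∀ k : ℤ, z ≠ p ^ k) (n : ℤ) :
    (1 - p ^ (n + 2)) * solCoeff p z (n + 2) + (1 + z) * p ^ (n + 3) * solCoeff p z (n + 1) +
      z * p ^ (2 * n + 5) * solCoeff p z n = 0 := by
  have h := connSeq_recurrence hp0 hp1 hz0 hz n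
  have s0 := two_mul_shifted_triangle n
  have s1 := two_mul_shifted_triangle (n + 1)
  have s2 := two_mul_shifted_triangle (n + 2)
  have e1 : (n + 2) * (n + 2 + 3) / 2 = n * (n + 3) / 2 + (2 * n + 5) := by linarith
  have e2 : (n + 1) * (n + 1 + 3) / 2 = n * (n + 3) / 2 + (n + 2) := by linarith
  have g1 : p ^ (n + 3) * p ^ (n + 2) = p ^ (2 * n + 5) := by
    rw [← zpow_add₀ hp0]; congr 1; ring
  have m1 : (-1 : ℂ) ^ (n + 1) = -(-1) ^ n := by rw [zpow_add₀ (by norm_num)]; simp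
  have m2 : (-1 : ℂ) ^ (n + 2) = (-1) ^ n := by rw [zpow_add₀ (by norm_num)]; norm_num
  simp only [solCoeff]
  rw [e1, e2, m1, m2, zpow_add₀ hp0 (n * (n + 3) / 2), zpow_add₀ hp0 (n * (n + 3) / 2), ← g1]
  linear_combination (-1) ^ n * p ^ (n * (n + 3) / 2) * (p ^ (n + 3) * p ^ (n + 2)) * h

lemma solCoeff_one {p z : ℂ} (hp0 : p ≠ 0) (hp1 : ‖p‖ < 1) (hz0 : z ≠ 0)
    (hz : ∀ k : ℤ, z ≠ p ^ k) : (1 - p) * solCoeff p z 1 + (1 + z) * p ^ 2 = 0 := by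
  have h := solCoeff_recurrence hp0 hp1 hz0 hz (-1)
  rw [solCoeff_of_neg hp0 hp1 hz0 hz (by norm_num : (-1 : ℤ) < 0)] at h
  norm_num [solCoeff_zero hp0 hp1 hz0 hz] at h
  exact_mod_cast h

/-! ### The theta function -/

lemma summable_norm_theta {p x : ℂ} (hp0 : p ≠ 0) (hp1 : ‖p‖ < 1) (hx : x ≠ 0) :
    Summable fun n : ℤ => ‖p ^ (n * (n - 1) / 2) * x ^ n‖ := by
  have h := tendsto_pow_nhds_zero hp1
  refine Summable.of_nat_of_neg ?_ ?_
  · refine summable_norm_of_ratio (g := fun n => p ^ n * x) (fun n => ?_)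
      (by simpa using h.mul_const x)
    push_cast
    rw [triangle_add_one, zpow_add₀ hp0, zpow_add₀ hx]
    simp only [zpow_natCast, zpow_one]
    ring
  · refine summable_norm_of_ratio (g := fun n => p ^ n * (p * x⁻¹)) (fun n => ?_)
      (by simpa using h.mul_const (p * x⁻¹))
    have := triangle_add_one (-(n + 1))
    rw [show (-(n + 1) + 1 : ℤ) = -n by ring] at this
    push_cast
    rw [show (-(n + 1) : ℤ) * (-(n + 1) - 1) / 2 = -n * (-n - 1) / 2 + n + 1 by linarith,
      zpow_add₀ hp0, zpow_add₀ hp0, show (-(n + 1) : ℤ) = -n + -1 by ring, zpow_add₀ hx]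
    simp only [zpow_natCast, zpow_one]
    simp
    ring

lemma hasSum_theta {p x : ℂ} (hp0 : p ≠ 0) (hp1 : ‖p‖ < 1) (hx : x ≠ 0) :
    HasSum (fun n : ℤ => p ^ (n * (n - 1) / 2) * x ^ n) (theta p x) :=
  (summable_norm_theta hp0 hp1 hx).of_norm.hasSum

lemma mul_theta_mul {p x : ℂ} (hp0 : p ≠ 0) (hp1 : ‖p‖ < 1) (hx : x ≠ 0) :
    x * theta p (p * x) = theta p x := by
  have h1 := (hasSum_theta hp0 hp1 (mul_ne_zero hp0 hx)).mul_left x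
  have h2 := (Equiv.addRight (1 : ℤ)).hasSum_iff.2 (hasSum_theta hp0 hp1 hx)
  refine h1.unique (h2.congr_fun fun n => ?_)
  simp only [Function.comp, Equiv.coe_addRight]
  rw [triangle_add_one, zpow_add₀ hp0, zpow_add₀ hx, mul_zpow, zpow_one]
  ring

/-- The reflection `n ↦ 1 - n` preserves `n(n-1)/2` and reverses the sign `(-1)^n`. -/
lemma theta_neg_one {p : ℂ} (hp0 : p ≠ 0) (hp1 : ‖p‖ < 1) : theta p (-1) = 0 := by
  have h1 := hasSum_theta hp0 hp1 (x := -1) (by norm_num)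
  have h2 := (Equiv.subLeft (1 : ℤ)).hasSum_iff.2 h1
  have h3 := h2.unique (h1.neg.congr_fun fun n => ?_)
  · linear_combination h3 / 2
  · simp only [Function.comp, Equiv.subLeft_apply]
    rw [show (1 - n) * (1 - n - 1) = n * (n - 1) by ring, zpow_sub₀ (by norm_num)]
    rcases Int.even_or_odd n with hn | hn <;> simp [hn.neg_one_zpow]

lemma theta_zpow_mul_eq_zero_iff {p x : ℂ} (hp0 : p ≠ 0) (hp1 : ‖p‖ < 1) (hx : x ≠ 0) (k : ℤ) :
    theta p (p ^ k * x) = 0 ↔ theta p x = 0 := by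
  have step : ∀ k : ℤ, theta p (p ^ (k + 1) * x) = 0 ↔ theta p (p ^ k * x) = 0 := fun k => by
    have hx' := mul_ne_zero (zpow_ne_zero k hp0) hx
    rw [← mul_theta_mul hp0 hp1 hx', ← mul_assoc, zpow_add_one₀ hp0, mul_comm p (p ^ k),
      mul_eq_zero, or_iff_right hx']
  induction k with
  | zero => simp
  | succ n ih => exact (step n).trans ih
  | pred n ih =>
    have := step (-n - 1)
    rw [sub_add_cancel] at this
    exact this.symm.trans ih

/-- Otherwise integrating the Laurent series termwise over the unit circle would give `0`, whereas
the constant term contributes `2π`. -/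
lemma exists_theta_ne_zero {p : ℂ} (hp0 : p ≠ 0) (hp1 : ‖p‖ < 1) :
    ∃ x : ℂ, x ≠ 0 ∧ theta p x ≠ 0 := by
  by_contra! hcon
  let e : ℝ → ℂ := fun φ => Complex.exp (Complex.I * φ)
  have he : Continuous e := by fun_prop
  have hen : ∀ φ, ‖e φ‖ = 1 := fun φ => by
    simp [e, mul_comm Complex.I, Complex.norm_exp_ofReal_mul_I]
  have he0 : ∀ φ, e φ ≠ 0 := fun φ => Complex.exp_ne_zero _
  have hs := summable_norm_theta hp0 hp1 (x := 1) one_ne_zero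
  have h := intervalIntegral.hasSum_integral_of_dominated_convergence
    (a := 0) (b := 2 * Real.pi) (μ := MeasureTheory.volume) (f := fun _ => (0 : ℂ))
    (F := fun (n : ℤ) φ => p ^ (n * (n - 1) / 2) * e φ ^ n)
    (fun n _ => ‖p ^ (n * (n - 1) / 2) * 1 ^ n‖)
    (fun n => (continuous_const.mul (he.zpow₀ n fun φ => Or.inl (he0 φ))).aestronglyMeasurable)
    (fun n => Eventually.of_forall fun φ _ => by simp [hen])
    (Eventually.of_forall fun _ _ => hs)
    (by simp)
    (Eventually.of_forall fun φ _ => by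
      have := hasSum_theta hp0 hp1 (he0 φ)
      rwa [hcon _ (he0 φ)] at this)
  have h' := hasSum_single (f := fun n : ℤ =>
    ∫ φ in (0 : ℝ)..(2 * Real.pi), p ^ (n * (n - 1) / 2) * e φ ^ n) 0 fun n hn => by
      rw [intervalIntegral.integral_const_mul]
      have hc : (n : ℂ) * Complex.I ≠ 0 := mul_ne_zero (by exact_mod_cast hn) Complex.I_ne_zero
      have : ∀ φ : ℝ, e φ ^ n = Complex.exp (n * Complex.I * φ) := fun φ => by
        simp only [e]
        rw [← Complex.exp_int_mul]
        congr 1; ring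
      simp only [this]
      rw [integral_exp_mul_complex hc]
      have h2 := Complex.exp_int_mul_two_pi_mul_I n
      rw [show (n : ℂ) * Complex.I * ((2 * Real.pi : ℝ) : ℂ) =
        n * (2 * Real.pi * Complex.I) by push_cast; ring, h2]
      simp
  have := h.unique h'
  simp [Real.pi_ne_zero] at this

/-! ### The confluent series and its product with theta -/

lemma basicHyp_eq (b p x : ℂ) : basicHyp [0] [b] p x =
    ∑' j : ℕ, (-1) ^ j * p ^ (j * (j - 1) / 2) / (qPoch b p j * qPoch p p j) * x ^ j := by
  simp only [basicHyp]
  refine tsum_congr fun j => ?_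
  have : qPoch 0 p j = 1 := by simp [qPoch]
  have h1 : (1 + (([b] : List ℂ).length : ℤ) - (([0] : List ℂ).length : ℤ)) = 1 := by simp
  rw [h1, zpow_one]
  simp only [List.map_cons, List.map_nil, List.prod_cons, List.prod_nil, this, mul_one]
  ring

lemma summable_norm_basicHyp (b x : ℂ) {p : ℂ} (hp1 : ‖p‖ < 1) : Summable fun j : ℕ =>
    ‖(-1) ^ j * p ^ (j * (j - 1) / 2) / (qPoch b p j * qPoch p p j) * x ^ j‖ := by
  refine summable_norm_of_ratio
    (g := fun j => -p ^ j / ((1 - b * p ^ j) * (1 - p * p ^ j)) * x) (fun j => ?_) ?_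
  · rw [Nat.triangle_succ, qPoch_succ, qPoch_succ]
    rw [show ∀ a b c d : ℂ, a * b * (c * d) = (a * c) * (b * d) by intros; ring,
      pow_add p]
    simp only [div_eq_mul_inv, mul_inv]
    ring
  · have h := tendsto_pow_nhds_zero hp1
    have h1 : Tendsto (fun j : ℕ => -p ^ j / ((1 - b * p ^ j) * (1 - p * p ^ j)) * x) atTop
        (𝓝 (-0 / ((1 - b * 0) * (1 - p * 0)) * x)) := by
      refine Tendsto.mul_const _ (Tendsto.div h.neg ?_ (by simp))
      exact (tendsto_const_nhds.sub (h.const_mul _)).mul (tendsto_const_nhds.sub (h.const_mul _))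
    simpa using h1

/-- The signs `(-1)^j` cancel. With `T(m) = m(m-1)/2`, the exponents combine by `T(n+j) + 2(n+j) +
T(j) = n(n+3)/2 + (j²+j) + nj`. -/
lemma theta_term_mul_basicHyp_term {p w t : ℂ} (hp0 : p ≠ 0) (hw : w ≠ 0) (ht : t ≠ 0)
    (n : ℤ) (j : ℕ) :
    p ^ ((n + j) * (n + j - 1) / 2) * (-(w * p ^ 2 * t)) ^ (n + j) *
      ((-1) ^ j * p ^ (j * (j - 1) / 2) / (qPoch (p * w) p j * qPoch p p j) * t⁻¹ ^ j) =
    (-1) ^ n * p ^ (n * (n + 3) / 2) * w ^ n * t ^ n * (tau p w j * (p ^ n) ^ j) := by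
  have hexp : p ^ ((n + j) * (n + j - 1) / 2) * p ^ (2 * (n + j)) * p ^ (j * (j - 1) / 2) =
      p ^ (n * (n + 3) / 2) * p ^ (j ^ 2 + j) * (p ^ n) ^ j := by
    rw [← zpow_natCast p (j * (j - 1) / 2), ← zpow_natCast p (j ^ 2 + j),
      ← zpow_natCast (p ^ n) j, ← zpow_mul, ← zpow_add₀ hp0, ← zpow_add₀ hp0, ← zpow_add₀ hp0,
      ← zpow_add₀ hp0]
    congr 1
    have a1 := two_mul_triangle (n + j)
    have a2 := two_mul_triangle (j : ℤ)
    have a3 := two_mul_shifted_triangle n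
    have a4 : ((j * (j - 1) / 2 : ℕ) : ℤ) = (j : ℤ) * (j - 1) / 2 := by
      rcases j with _ | j <;> simp
    rw [a4]
    push_cast
    linarith
  have hpow : (-(w * p ^ 2 * t)) ^ (n + j) =
      (-1) ^ n * (-1) ^ j * (w ^ n * w ^ j) * p ^ (2 * (n + j)) * (t ^ n * t ^ j) := by
    have h2 : (p ^ 2) ^ (n + j) = p ^ (2 * (n + j)) := by
      rw [zpow_mul]; rfl
    rw [neg_eq_neg_one_mul, mul_zpow, mul_zpow, mul_zpow, h2, zpow_add₀ (by norm_num),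
      zpow_add₀ hw, zpow_add₀ ht, zpow_natCast, zpow_natCast, zpow_natCast]
    ring
  have hsq : (-1 : ℂ) ^ j * (-1) ^ j = 1 := by rw [← mul_pow]; simp
  have htj : t ^ j * t⁻¹ ^ j = 1 := by rw [← mul_pow]; simp [ht]
  rw [hpow, tau]
  calc _ = ((-1) ^ j * (-1) ^ j) * (t ^ j * t⁻¹ ^ j) *
        (p ^ ((n + j) * (n + j - 1) / 2) * p ^ (2 * (n + j)) * p ^ (j * (j - 1) / 2)) *
        ((-1) ^ n * w ^ n * w ^ j * t ^ n / (qPoch (p * w) p j * qPoch p p j)) := by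
        generalize p ^ ((n + j) * (n + j - 1) / 2) = x1
        generalize p ^ (2 * (n + j)) = x2
        generalize p ^ (j * (j - 1) / 2) = x3
        generalize t⁻¹ ^ j = x4
        generalize qPoch (p * w) p j * qPoch p p j = x5
        ring
    _ = _ := by
        rw [hexp, hsq, htj]
        generalize p ^ (n * (n + 3) / 2) = x1
        generalize p ^ (j ^ 2 + j) = x2
        generalize (p ^ n) ^ j = x3
        generalize qPoch (p * w) p j * qPoch p p j = x5
        ring

lemma hasSum_mul_of_summable_norm {ι κ : Type*} {f : ι → ℂ} {g : κ → ℂ} {s t : ℂ}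
    (hf : HasSum f s) (hg : HasSum g t) (hf' : Summable fun i => ‖f i‖)
    (hg' : Summable fun i => ‖g i‖) : HasSum (fun x : ι × κ => f x.1 * g x.2) (s * t) :=
  hf.mul hg (summable_mul_of_summable_norm hf' hg')

/-- The Laurent expansion of the product of a theta function with a `₁φ₁`. -/
lemma hasSum_theta_mul_basicHyp {p w t : ℂ} (hp0 : p ≠ 0) (hp1 : ‖p‖ < 1) (hw : w ≠ 0)
    (ht : t ≠ 0) : HasSum
      (fun n : ℤ => (-1) ^ n * p ^ (n * (n + 3) / 2) * (w ^ n * tauSeries p w (p ^ n)) * t ^ n)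
      (theta p (-(w * p ^ 2 * t)) * basicHyp [0] [p * w] p t⁻¹) := by
  have hT : -(w * p ^ 2 * t) ≠ 0 :=
    neg_ne_zero.2 (mul_ne_zero (mul_ne_zero hw (pow_ne_zero 2 hp0)) ht)
  have s1 := summable_norm_theta hp0 hp1 hT
  have s2 := summable_norm_basicHyp (p * w) t⁻¹ hp1
  have h1 := hasSum_theta hp0 hp1 hT
  have h2 := s2.of_norm.hasSum
  rw [← basicHyp_eq] at h2
  have h3 := hasSum_mul_of_summable_norm h1 h2 s1 s2
  -- This shear makes the first index the total power of `t`, since the `j`-th term of the second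
  -- factor carries `t⁻¹ ^ j`.
  obtain ⟨E, hE⟩ : ∃ E : ℤ × ℕ ≃ ℤ × ℕ, ∀ x, E x = (x.1 + x.2, x.2) :=
    ⟨{  toFun := fun x => (x.1 + x.2, x.2)
        invFun := fun x => (x.1 - x.2, x.2)
        left_inv := fun x => by simp
        right_inv := fun x => by simp }, fun _ => rfl⟩
  have h4 := (E.hasSum_iff.2 h3).congr_fun
    (g := fun x : ℤ × ℕ => (-1) ^ x.1 * p ^ (x.1 * (x.1 + 3) / 2) * w ^ x.1 * t ^ x.1 *
      (tau p w x.2 * (p ^ x.1) ^ x.2))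
    (fun x => by
      rw [Function.comp_apply, hE, ← theta_term_mul_basicHyp_term hp0 hw ht x.1 x.2])
  refine h4.prod_fiberwise fun n => ?_
  have h5 := (hasSum_tauSeries p w (p ^ n) hp1).mul_left
    ((-1) ^ n * p ^ (n * (n + 3) / 2) * w ^ n * t ^ n)
  rwa [show (-1) ^ n * p ^ (n * (n + 3) / 2) * w ^ n * t ^ n * tauSeries p w (p ^ n) =
    (-1) ^ n * p ^ (n * (n + 3) / 2) * (w ^ n * tauSeries p w (p ^ n)) * t ^ n by ring] at h5

/-- The numerator of the right-hand side of the connection formula. -/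
def connRHS (p z t : ℂ) : ℂ :=
  1 / (qPochInf z⁻¹ p * qPochInf p p) *
      (theta p (-(z * p ^ 2 * t)) * basicHyp [0] [p * z] p t⁻¹) +
    1 / (qPochInf z p * qPochInf p p) *
      (theta p (-(p ^ 2 * t)) * basicHyp [0] [p * z⁻¹] p (z⁻¹ * t⁻¹))

lemma hasSum_solCoeff {p z t : ℂ} (hp0 : p ≠ 0) (hp1 : ‖p‖ < 1) (hz0 : z ≠ 0)
    (hz : ∀ k : ℤ, z ≠ p ^ k) (ht : t ≠ 0) :
    HasSum (fun n : ℕ => solCoeff p z n * t ^ n) (connRHS p z t) := by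
  have h1 := hasSum_theta_mul_basicHyp hp0 hp1 hz0 ht
  -- Expanding at `z t` cancels the factor `z⁻¹ ^ n` and gives the second term of `connSeq`.
  have h2 := hasSum_theta_mul_basicHyp hp0 hp1 (inv_ne_zero hz0) (mul_ne_zero hz0 ht)
  rw [show z⁻¹ * p ^ 2 * (z * t) = p ^ 2 * t by field_simp, mul_inv] at h2
  have h := (h1.mul_left (1 / (qPochInf z⁻¹ p * qPochInf p p))).add
    (h2.mul_left (1 / (qPochInf z p * qPochInf p p)))
  have h3 : HasSum (fun n : ℤ => solCoeff p z n * t ^ n) (connRHS p z t) := by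
    refine h.congr_fun fun n => ?_
    have : z⁻¹ ^ n * z ^ n = 1 := by rw [← mul_zpow]; simp [hz0]
    simp only [solCoeff, connSeq, mul_zpow]
    linear_combination (-1 / (qPochInf z p * qPochInf p p)) * ((-1) ^ n * p ^ (n * (n + 3) / 2) *
      tauSeries p z⁻¹ (p ^ n) * t ^ n) * this
  rw [← Nat.cast_injective.hasSum_iff (f := fun n : ℤ => solCoeff p z n * t ^ n)] at h3
  · simpa [Function.comp_def] using h3
  · intro n hn
    rw [solCoeff_of_neg hp0 hp1 hz0 hz, zero_mul]
    by_contra! h0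
    exact hn ⟨n.toNat, Int.toNat_of_nonneg h0⟩

lemma summable_solCoeff {p z : ℂ} (hp0 : p ≠ 0) (hp1 : ‖p‖ < 1) (hz0 : z ≠ 0)
    (hz : ∀ k : ℤ, z ≠ p ^ k) (t : ℂ) : Summable fun n : ℕ => solCoeff p z n * t ^ n := by
  rcases eq_or_ne t 0 with rfl | ht
  · exact (hasSum_single 0 fun n hn => by simp [hn]).summable
  · exact (hasSum_solCoeff hp0 hp1 hz0 hz ht).summable

/-! ### The functional equation of the numerator -/

/-- The coefficients of `z p⁵ t² f(p²t) + (p²(1+z)t - 1) f(pt) + f(t)` for `f = ∑ a_n t^n`. -/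
def eqCoeff (p z : ℂ) (a : ℕ → ℂ) : ℕ → ℂ
  | 0 => 0
  | 1 => (1 - p) * a 1 + (1 + z) * p ^ 2 * a 0
  | n + 2 => (1 - p ^ (n + 2)) * a (n + 2) + (1 + z) * p ^ (n + 3) * a (n + 1) +
      z * p ^ (2 * n + 5) * a n

lemma hasSum_eqCoeff (p z : ℂ) {a : ℕ → ℂ} {t f0 f1 f2 : ℂ}
    (h0 : HasSum (fun n => a n * t ^ n) f0) (h1 : HasSum (fun n => a n * (p * t) ^ n) f1)
    (h2 : HasSum (fun n => a n * (p ^ 2 * t) ^ n) f2) :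
    HasSum (fun n => eqCoeff p z a n * t ^ n)
      (z * p ^ 5 * t ^ 2 * f2 + (p ^ 2 * (1 + z) * t - 1) * f1 + f0) := by
  have k0 := (hasSum_nat_add_iff' 2).2 h0
  have k1 := (hasSum_nat_add_iff' 1).2 h1
  have k1' := (hasSum_nat_add_iff' 2).2 h1
  rw [← hasSum_nat_add_iff' 2]
  have h := (((h2.mul_left (z * p ^ 5 * t ^ 2)).add (k1.mul_left (p ^ 2 * (1 + z) * t))).sub
    k1').add k0
  have e : z * p ^ 5 * t ^ 2 * f2 + (p ^ 2 * (1 + z) * t - 1) * f1 + f0 -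
      ∑ i ∈ range 2, eqCoeff p z a i * t ^ i =
      z * p ^ 5 * t ^ 2 * f2 +
        p ^ 2 * (1 + z) * t * (f1 - ∑ i ∈ range 1, a i * (p * t) ^ i) -
        (f1 - ∑ i ∈ range 2, a i * (p * t) ^ i) + (f0 - ∑ i ∈ range 2, a i * t ^ i) := by
    simp [sum_range_succ, eqCoeff]
    ring
  rw [e]
  refine h.congr_fun fun n => ?_
  simp only [eqCoeff]
  ring

/-- Each relation of index `n ≥ 1` determines `a n` from earlier terms, as `p^n ≠ 1`. Index `0` is
vacuous, so `a 0` is the only free parameter. -/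
lemma eq_of_eqCoeff_eq_zero {p z : ℂ} (hp1 : ‖p‖ < 1) {a b : ℕ → ℂ} (h0 : a 0 = b 0)
    (ha : ∀ n, eqCoeff p z a n = 0) (hb : ∀ n, eqCoeff p z b n = 0) : a = b := by
  have hne : ∀ n : ℕ, 1 - p ^ (n + 1) ≠ 0 := fun n => by
    rw [pow_succ']
    exact sub_ne_zero.2 (self_mul_pow_ne_one hp1 n).symm
  have key : ∀ n, a n = b n ∧ a (n + 1) = b (n + 1) := fun n => by
    induction n with
    | zero =>
      refine ⟨h0, mul_left_cancel₀ (hne 0) ?_⟩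
      have h1 := ha 1
      have h2 := hb 1
      simp only [eqCoeff] at h1 h2
      simp only [zero_add, pow_one]
      linear_combination h1 - h2 - (1 + z) * p ^ 2 * h0
    | succ n ih =>
      refine ⟨ih.2, mul_left_cancel₀ (hne (n + 1)) ?_⟩
      have h1 := ha (n + 2)
      have h2 := hb (n + 2)
      simp only [eqCoeff] at h1 h2
      linear_combination h1 - h2 - (1 + z) * p ^ (n + 3) * ih.2 - z * p ^ (2 * n + 5) * ih.1
  exact funext fun n => (key n).1

lemma eqCoeff_solCoeff {p z : ℂ} (hp0 : p ≠ 0) (hp1 : ‖p‖ < 1) (hz0 : z ≠ 0)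
    (hz : ∀ k : ℤ, z ≠ p ^ k) (n : ℕ) : eqCoeff p z (fun n => solCoeff p z n) n = 0 := by
  match n with
  | 0 => rfl
  | 1 =>
    simp only [eqCoeff, Nat.cast_one, Nat.cast_zero, solCoeff_zero hp0 hp1 hz0 hz, mul_one]
    exact solCoeff_one hp0 hp1 hz0 hz
  | n + 2 =>
    have := solCoeff_recurrence hp0 hp1 hz0 hz n
    simp only [eqCoeff]
    push_cast
    exact_mod_cast this

/-- A power series that vanishes at points accumulating at the origin is zero. -/
lemma coeff_eq_zero_of_frequently {b : ℕ → ℂ} {F : ℂ → ℂ}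
    (hF : ∀ᶠ t in 𝓝 0, HasSum (fun n => b n * t ^ n) (F t))
    (h0 : ∃ᶠ t in 𝓝[≠] 0, F t = 0) (n : ℕ) : b n = 0 := by
  have hs : HasFPowerSeriesAt F (FormalMultilinearSeries.ofScalars ℂ b) 0 := by
    rw [hasFPowerSeriesAt_iff]
    filter_upwards [hF] with t ht
    simpa [FormalMultilinearSeries.coeff_ofScalars, mul_comm] using ht
  have h := hs.eq_zero_of_eventually (hs.analyticAt.frequently_zero_iff_eventually_zero.1 h0)
  rw [FormalMultilinearSeries.ofScalars_series_eq_zero] at h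
  exact congrFun h n

/-! ### From the Hahn–Exton equation to the recurrence and back -/

section

variable {p ν : ℂ}

lemma cpow_two_mul_eq_sq (p ν : ℂ) (hp0 : p ≠ 0) : p ^ (2 * ν) = (p ^ ν) ^ 2 := by
  rw [two_mul, Complex.cpow_add _ _ hp0, sq]

lemma cpow_add_two (ν : ℂ) (hp0 : p ≠ 0) : p ^ (ν + 2) = p ^ ν * p ^ 2 := by
  rw [Complex.cpow_add _ _ hp0, Complex.cpow_ofNat]

/-- With `T = -p^(ν+2) t`, quasi-periodicity turns the prefactors at `pt` and `p²t` into `T/θ(T)`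
and `pT²/θ(T)`. Zeros of theta need no exclusion, because `0⁻¹ = 0` respects these identities. -/
lemma hahnExtonEqAt_iff (hp0 : p ≠ 0) (hp1 : ‖p‖ < 1) (a : ℕ → ℂ) {t : ℂ} (ht : t ≠ 0) :
    HahnExtonEqAt p ν (zFun p ν a) t ↔
      (theta p (-(p ^ (ν + 2) * t)))⁻¹ *
        (p ^ (2 * ν) * p ^ 5 * t ^ 2 * (∑' n, a n * (p ^ 2 * t) ^ n) +
          (p ^ 2 * (1 + p ^ (2 * ν)) * t - 1) * (∑' n, a n * (p * t) ^ n) +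
          ∑' n, a n * t ^ n) = 0 := by
  have hc : p ^ ν ≠ 0 := by simp [Complex.cpow_eq_zero_iff, hp0]
  have hT : -(p ^ (ν + 2) * t) ≠ 0 := by simp [Complex.cpow_eq_zero_iff, hp0, ht]
  have h1 := mul_theta_mul hp0 hp1 hT
  have h2 := mul_theta_mul hp0 hp1 (mul_ne_zero hp0 hT)
  have e1 : (theta p (p * -(p ^ (ν + 2) * t)))⁻¹ =
      -(p ^ (ν + 2) * t) * (theta p (-(p ^ (ν + 2) * t)))⁻¹ := by
    rw [← h1, mul_inv, mul_inv_cancel_left₀ hT]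
  have e2 : (theta p (p * (p * -(p ^ (ν + 2) * t))))⁻¹ =
      p * -(p ^ (ν + 2) * t) * (-(p ^ (ν + 2) * t) * (theta p (-(p ^ (ν + 2) * t)))⁻¹) := by
    rw [← e1, ← h2, mul_inv, mul_inv_cancel_left₀ (mul_ne_zero hp0 hT)]
  simp only [HahnExtonEqAt, zFun]
  rw [show -(p ^ (ν + 2) * (p ^ 2 * t)) = p * (p * -(p ^ (ν + 2) * t)) by ring,
    show -(p ^ (ν + 2) * (p * t)) = p * -(p ^ (ν + 2) * t) by ring, e1, e2]
  have n1 : p ^ (-2 - ν) = (p ^ ν * p ^ 2)⁻¹ := by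
    rw [← cpow_add_two ν hp0, ← Complex.cpow_neg]; congr 1; ring
  rw [n1, Complex.cpow_neg, cpow_two_mul_eq_sq p ν hp0, cpow_add_two ν hp0]
  generalize (theta p (-(p ^ ν * p ^ 2 * t)))⁻¹ = θ
  generalize (∑' n, a n * (p ^ 2 * t) ^ n) = f2
  generalize (∑' n, a n * (p * t) ^ n) = f1
  generalize (∑' n, a n * t ^ n) = f0
  generalize p ^ ν = c at *
  refine Eq.congr_left ?_
  field_simp
  ring

lemma eqCoeff_of_isSolution (hp0 : p ≠ 0) (hp1 : ‖p‖ < 1) {a : ℕ → ℂ}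
    (ha : IsSolutionAtInfinity p ν a) (n : ℕ) : eqCoeff p (p ^ (2 * ν)) a n = 0 := by
  obtain ⟨-, r, hr, hsum, heq⟩ := ha
  have hc : p ^ (ν + 2) ≠ 0 := by simp [Complex.cpow_eq_zero_iff, hp0]
  have hlt : ∀ {t : ℂ}, ‖t‖ < r → ‖p * t‖ < r := fun {t} h => by
    rw [norm_mul]
    exact (mul_le_of_le_one_left (norm_nonneg t) hp1.le).trans_lt h
  refine coeff_eq_zero_of_frequently (F := fun t => p ^ (2 * ν) * p ^ 5 * t ^ 2 *
      (∑' n, a n * (p ^ 2 * t) ^ n) + (p ^ 2 * (1 + p ^ (2 * ν)) * t - 1) *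
      (∑' n, a n * (p * t) ^ n) + ∑' n, a n * t ^ n) ?_ ?_ n
  · filter_upwards [Metric.ball_mem_nhds (0 : ℂ) hr] with t ht
    rw [mem_ball_zero_iff] at ht
    refine hasSum_eqCoeff p _ (hsum t ht).hasSum (hsum _ (hlt ht)).hasSum (hsum _ ?_).hasSum
    rw [sq, mul_assoc]
    exact hlt (hlt ht)
  -- Scaling one point where theta is nonzero by `p^m` gives points tending to `0` at which the
  -- prefactor can be cancelled.
  · obtain ⟨x, hx, hθ⟩ := exists_theta_ne_zero hp0 hp1
    have hu0 : ∀ m : ℕ, p ^ m * (-x / p ^ (ν + 2)) ≠ 0 := fun m =>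
      mul_ne_zero (pow_ne_zero m hp0) (div_ne_zero (neg_ne_zero.2 hx) hc)
    have hu : Tendsto (fun m : ℕ => p ^ m * (-x / p ^ (ν + 2))) atTop (𝓝 0) := by
      simpa using (tendsto_pow_nhds_zero hp1).mul_const (-x / p ^ (ν + 2))
    have hu' : Tendsto (fun m : ℕ => p ^ m * (-x / p ^ (ν + 2))) atTop (𝓝[≠] 0) :=
      tendsto_nhdsWithin_iff.2 ⟨hu, Eventually.of_forall hu0⟩
    refine hu'.frequently (Eventually.frequently ?_)
    filter_upwards [hu.eventually (Metric.ball_mem_nhds (0 : ℂ) hr)] with m hm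
    rw [dist_zero_right] at hm
    have hT : -(p ^ (ν + 2) * (p ^ m * (-x / p ^ (ν + 2)))) = p ^ (m : ℤ) * x := by
      rw [zpow_natCast]; field_simp
    have hθ' : theta p (-(p ^ (ν + 2) * (p ^ m * (-x / p ^ (ν + 2))))) ≠ 0 := by
      rwa [hT, Ne, theta_zpow_mul_eq_zero_iff hp0 hp1 hx]
    -- On the spiral the theta argument would be `-p^(-k)`, a zero of theta.
    have hspiral : 1 / (p ^ m * (-x / p ^ (ν + 2))) ∉ qSpiral (p ^ (ν + 2)) p := by
      rintro ⟨k, hk⟩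
      apply hθ'
      have : -(p ^ (ν + 2) * (p ^ m * (-x / p ^ (ν + 2)))) = p ^ (-k) * (-1) := by
        have hu1 := hu0 m
        have hpk : p ^ k ≠ 0 := zpow_ne_zero k hp0
        generalize p ^ m * (-x / p ^ (ν + 2)) = u at *
        rw [zpow_neg]
        field_simp at hk ⊢
        linear_combination hk
      rw [this, theta_zpow_mul_eq_zero_iff hp0 hp1 (by norm_num), theta_neg_one hp0 hp1]
    exact (mul_eq_zero.1 ((hahnExtonEqAt_iff hp0 hp1 a (hu0 m)).1
      (heq _ (hu0 m) hm hspiral))).resolve_left (inv_ne_zero hθ')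

lemma isSolution_solCoeff (hp0 : p ≠ 0) (hp1 : ‖p‖ < 1)
    (hν : ∀ k : ℤ, p ^ (2 * ν) ≠ p ^ k) :
    IsSolutionAtInfinity p ν fun n => solCoeff p (p ^ (2 * ν)) n := by
  have hz0 : p ^ (2 * ν) ≠ 0 := by simp [Complex.cpow_eq_zero_iff, hp0]
  have hs := summable_solCoeff hp0 hp1 hz0 hν
  -- The series converges everywhere, so the radius `1` is arbitrary.
  refine ⟨by simpa using solCoeff_zero hp0 hp1 hz0 hν, 1, one_pos, fun t _ => hs t,
    fun t ht _ _ => ?_⟩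
  rw [hahnExtonEqAt_iff hp0 hp1 _ ht]
  have h := hasSum_eqCoeff p (p ^ (2 * ν)) (hs t).hasSum (hs (p * t)).hasSum
    (hs (p ^ 2 * t)).hasSum
  simp only [eqCoeff_solCoeff hp0 hp1 hz0 hν, zero_mul] at h
  rw [h.unique hasSum_zero, mul_zero]

lemma isSolution_iff (hp0 : p ≠ 0) (hp1 : ‖p‖ < 1) (hν : ∀ k : ℤ, p ^ (2 * ν) ≠ p ^ k)
    (a : ℕ → ℂ) :
    IsSolutionAtInfinity p ν a ↔ a = fun n : ℕ => solCoeff p (p ^ (2 * ν)) n := by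
  have hsol := isSolution_solCoeff hp0 hp1 hν
  refine ⟨fun ha => ?_, fun h => h ▸ hsol⟩
  exact eq_of_eqCoeff_eq_zero hp1 (ha.1.trans hsol.1.symm)
    (eqCoeff_of_isSolution hp0 hp1 ha) (eqCoeff_of_isSolution hp0 hp1 hsol)

end

end HahnExton

end

theorem theorem1 (p ν : ℂ) (hp0 : p ≠ 0) (hp1 : ‖p‖ < 1)
    (hν : ∀ k : ℤ, p ^ (2 * ν) ≠ p ^ k) :
    (∃! a : ℕ → ℂ, HahnExton.IsSolutionAtInfinity p ν a) ∧
    ∀ a : ℕ → ℂ, HahnExton.IsSolutionAtInfinity p ν a →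
      (∀ t : ℂ, Summable fun n : ℕ => a n * t ^ n) ∧
      ∀ x : ℂ, x ≠ 0 → x ∉ HahnExton.qSpiral (p ^ (ν + 2)) p →
        HahnExton.zFun p ν a (1 / x) =
          1 / (HahnExton.qPochInf (p ^ (-2 * ν)) p * HahnExton.qPochInf p p) *
              (HahnExton.theta p (-(p ^ (2 * ν + 2) / x)) /
                HahnExton.theta p (-(p ^ (ν + 2) / x))) *
              HahnExton.basicHyp [0] [p ^ (1 + 2 * ν)] p x +
          1 / (HahnExton.qPochInf (p ^ (2 * ν)) p * HahnExton.qPochInf p p) *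
              (HahnExton.theta p (-(p ^ 2 / x)) /
                HahnExton.theta p (-(p ^ (ν + 2) / x))) *
              HahnExton.basicHyp [0] [p ^ (1 - 2 * ν)] p (p ^ (-2 * ν) * x) := by
  have hz0 : p ^ (2 * ν) ≠ 0 := by simp [Complex.cpow_eq_zero_iff, hp0]
  refine ⟨⟨_, HahnExton.isSolution_solCoeff hp0 hp1 hν,
    fun a ha => (HahnExton.isSolution_iff hp0 hp1 hν a).1 ha⟩, fun a ha => ?_⟩
  rw [HahnExton.isSolution_iff hp0 hp1 hν] at ha
  subst ha
  refine ⟨HahnExton.summable_solCoeff hp0 hp1 hz0 hν, fun x hx _ => ?_⟩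
  have h := (HahnExton.hasSum_solCoeff hp0 hp1 hz0 hν (one_div_ne_zero hx)).tsum_eq
  have e1 : p ^ (2 * ν + 2) = p ^ (2 * ν) * p ^ 2 := HahnExton.cpow_add_two (2 * ν) hp0
  have e2 : p ^ (1 + 2 * ν) = p * p ^ (2 * ν) := by
    rw [Complex.cpow_add _ _ hp0, Complex.cpow_one]
  have e3 : p ^ (1 - 2 * ν) = p * (p ^ (2 * ν))⁻¹ := by
    rw [Complex.cpow_sub _ _ hp0, Complex.cpow_one, div_eq_mul_inv]
  have e4 : p ^ (-2 * ν) = (p ^ (2 * ν))⁻¹ := by rw [neg_mul, Complex.cpow_neg]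
  rw [HahnExton.zFun, h, HahnExton.connRHS, one_div x, inv_inv, e1, e2, e3, e4]
  simp only [div_eq_mul_inv]
  ring
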